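/- Let $n,m,p\ge 1$, let $Y_1,\dots,Y_m$ be independent random vectors with values in $[-1,1]^p$, and let $M=M(Y_1,\dots,Y_m)$ be a random symmetric $n\times n$ real matrix, where $M(\cdot)$ is linear, and Lipschitz with Lipschitz constant $C_M$ as a function from $[-1,1]^{mp}$ with the Euclidean norm to the symmetric $n\times n$ matrices with the Euclidean norm on $\mathbb R^{n(n+1)/2}$ (a symmetric matrix is viewed as the vector of its entries on and above the diagonal). Let $f:\mathbb R\to\mathbb R$ be convex and Lipschitz with Lipschitz constant $\|f\|_L$. Put $S=M/\sqrt m$ and $F_S(f)=\frac1n\sum_{i=1}^n f(\lambda_i(S))$, where $\lambda_1(S)\le\dots\le\lambda_n(S)$ are the eigenvalues of $S$ counted with multiplicity, and let $\operatorname{med}F_S(f)$ be any median of $F_S(f)$. Then, for each $\epsilon>0$, $$\mathbb P\bigl(|F_S(f)-\operatorname{med}F_S(f)|\ge\epsilon\bigr)\le 4\exp\left[-\frac{nm}{p}\,\frac{\epsilon^2}{32\,C_M^2\,\|f\|_L^2}\right],$$ where the right-hand side is read as $0$ if $C_M\|f\|_L=0$. -/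

import Mathlib

open MeasureTheory ProbabilityTheory
open scoped NNReal

/-- The real vector space of symmetric `n × n` real matrices. -/
def symMatrix (n : ℕ) : Submodule ℝ (Matrix (Fin n) (Fin n) ℝ) where
  carrier := {A | A.IsSymm}
  add_mem' hA hB := Matrix.IsSymm.add hA hB
  zero_mem' := Matrix.isSymm_zero
  smul_mem' c _ hA := Matrix.IsSymm.smul hA c

theorem symMatrix_isHermitian {n : ℕ} (A : symMatrix n) :
    (A : Matrix (Fin n) (Fin n) ℝ).IsHermitian := by
  have h : (A : Matrix (Fin n) (Fin n) ℝ).IsSymm := A.2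
  rw [Matrix.IsHermitian, Matrix.conjTranspose_eq_transpose_of_trivial]
  exact h

/-- A symmetric matrix viewed as a point of the Euclidean space `ℝ^(n(n+1)/2)`,
by collecting the entries on and above the diagonal. -/
noncomputable def upperEntries {n : ℕ} (A : symMatrix n) :
    EuclideanSpace ℝ {q : Fin n × Fin n // q.1 ≤ q.2} :=
  WithLp.toLp 2 (fun q => (A : Matrix (Fin n) (Fin n) ℝ) q.1.1 q.1.2)

/-- `F_A(f)`: the integral of `f` against the spectral distribution of `A`, i.e. the average of `f`
over the eigenvalues of `A`, counted with multiplicity. -/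
noncomputable def spectralAverage {n : ℕ} (A : symMatrix n) (f : ℝ → ℝ) : ℝ :=
  (1 / (n : ℝ)) * ∑ i, f ((symMatrix_isHermitian A).eigenvalues i)

/-- The cube `[-1,1]^{mp}` in the Euclidean space `ℝ^{mp}`. -/
def unitCube (m p : ℕ) : Set (EuclideanSpace ℝ (Fin m × Fin p)) :=
  {y | ∀ q, y q ∈ Set.Icc (-1 : ℝ) 1}

/-- The vectors `y_1, …, y_m` of `ℝ^p` stacked into one vector of the Euclidean space `ℝ^{mp}`. -/
noncomputable def stack {m p : ℕ} (y : Fin m → Fin p → ℝ) : EuclideanSpace ℝ (Fin m × Fin p) :=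
  WithLp.toLp 2 (fun q => y q.1 q.2)

/-- `c` is a median of the real random variable `X`. -/
def IsMedian {Ω : Type*} [MeasurableSpace Ω] (μ : Measure Ω) (X : Ω → ℝ) (c : ℝ) : Prop :=
  1 / 2 ≤ μ.real {ω | X ω ≤ c} ∧ 1 / 2 ≤ μ.real {ω | c ≤ X ω}

/-! ### Convexity and Lipschitz bound for spectral averages. -/

section Spectral

variable {n : ℕ}

/-! The spectral average of a convex Lipschitz `f` is a convex Lipschitz function of the independent
blocks, so Talagrand's convex concentration applies.

Peierls' inequality says that replacing eigenvalues by the diagonal entries in any orthonormal basis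
lowers the sum of a convex `f`. Working in the eigenbasis of a convex combination gives convexity
(`convexOn_spectralAverage`). Working in the eigenbasis of one of two matrices gives the Lipschitz
constant `L * √(2 / n)` (`spectralAverage_sub_le`). Composing with the linear map `M / √m` yields a
convex function of the blocks with constant `σ`, where `σ ^ 2 = 2 L² C² / (n m)`.

For the product law, the exponential moment of the cost of reaching a compact convex set `A` is at
most the inverse of the measure of `A`, if a displacement within one block costs at most `1 / 4`.
This is proved by induction on the number of blocks (`ConvexConcentration.prod`). Blocks in
`[-1,1]^p` allow the cost `|v|² / (16 p)`. A change of `ε` in the spectral average then costs at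
least `ε² / (16 p σ²)`, which is the exponent. Markov's inequality on sublevel sets and the
definition of a median give the two tails. -/

/-- The quadratic form `v ↦ ⟪v, A v⟫` of a real square matrix. -/
noncomputable def matrixQuadForm (A : Matrix (Fin n) (Fin n) ℝ) (v : EuclideanSpace ℝ (Fin n)) :
    ℝ :=
  inner ℝ v (Matrix.toEuclideanLin A v)

theorem matrixQuadForm_add (A B : Matrix (Fin n) (Fin n) ℝ) (v : EuclideanSpace ℝ (Fin n)) :
    matrixQuadForm (A + B) v = matrixQuadForm A v + matrixQuadForm B v := by
  simp [matrixQuadForm, inner_add_right]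

theorem matrixQuadForm_sub (A B : Matrix (Fin n) (Fin n) ℝ) (v : EuclideanSpace ℝ (Fin n)) :
    matrixQuadForm (A - B) v = matrixQuadForm A v - matrixQuadForm B v := by
  simp [matrixQuadForm, inner_sub_right]

theorem matrixQuadForm_smul (c : ℝ) (A : Matrix (Fin n) (Fin n) ℝ)
    (v : EuclideanSpace ℝ (Fin n)) :
    matrixQuadForm (c • A) v = c * matrixQuadForm A v := by
  simp [matrixQuadForm, inner_smul_right]

theorem toEuclideanLin_eigenvectorBasis {A : Matrix (Fin n) (Fin n) ℝ} (hA : A.IsHermitian)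
    (j : Fin n) :
    Matrix.toEuclideanLin A (hA.eigenvectorBasis j) =
      hA.eigenvalues j • hA.eigenvectorBasis j := by
  rw [Matrix.toLpLin_apply, hA.mulVec_eigenvectorBasis]
  rfl

theorem matrixQuadForm_eigenvectorBasis {A : Matrix (Fin n) (Fin n) ℝ} (hA : A.IsHermitian)
    (j : Fin n) : matrixQuadForm A (hA.eigenvectorBasis j) = hA.eigenvalues j := by
  rw [matrixQuadForm, toEuclideanLin_eigenvectorBasis, inner_smul_right,
    real_inner_self_eq_norm_sq, hA.eigenvectorBasis.orthonormal.1 j]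
  simp

theorem matrixQuadForm_eq_sum {A : Matrix (Fin n) (Fin n) ℝ} (hA : A.IsHermitian)
    (v : EuclideanSpace ℝ (Fin n)) :
    matrixQuadForm A v = ∑ j, inner ℝ (hA.eigenvectorBasis j) v ^ 2 * hA.eigenvalues j := by
  rw [matrixQuadForm, ← hA.eigenvectorBasis.sum_inner_mul_inner]
  refine Finset.sum_congr rfl fun j _ => ?_
  have hs := Matrix.isSymmetric_toEuclideanLin_iff.mpr hA
  rw [← hs, toEuclideanLin_eigenvectorBasis, real_inner_smul_left, real_inner_comm]
  ring

/-- **Peierls' inequality.** -/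
theorem sum_matrixQuadForm_le_sum_eigenvalues {A : Matrix (Fin n) (Fin n) ℝ}
    (hA : A.IsHermitian) (v : OrthonormalBasis (Fin n) ℝ (EuclideanSpace ℝ (Fin n)))
    {f : ℝ → ℝ} (hf : ConvexOn ℝ Set.univ f) :
    ∑ i, f (matrixQuadForm A (v i)) ≤ ∑ j, f (hA.eigenvalues j) := by
  have hle : ∀ i, f (matrixQuadForm A (v i)) ≤
      ∑ j, inner ℝ (hA.eigenvectorBasis j) (v i) ^ 2 * f (hA.eigenvalues j) := by
    intro i
    rw [matrixQuadForm_eq_sum hA]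
    -- Jensen: by Parseval the squared coordinates of a unit vector are weights of sum one. Summed
    -- over `i` instead, they are again one.
    refine hf.map_sum_le (fun j _ => sq_nonneg _) ?_ fun _ _ => Set.mem_univ _
    rw [hA.eigenvectorBasis.sum_sq_inner_right, v.orthonormal.1 i, one_pow]
  calc ∑ i, f (matrixQuadForm A (v i))
      ≤ ∑ i, ∑ j, inner ℝ (hA.eigenvectorBasis j) (v i) ^ 2 * f (hA.eigenvalues j) :=
        Finset.sum_le_sum fun i _ => hle i
    _ = ∑ j, f (hA.eigenvalues j) := by
        rw [Finset.sum_comm]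
        refine Finset.sum_congr rfl fun j _ => ?_
        rw [← Finset.sum_mul, v.sum_sq_inner_left, hA.eigenvectorBasis.orthonormal.1 j,
          one_pow, one_mul]

theorem sum_sq_norm_toEuclideanLin (D : Matrix (Fin n) (Fin n) ℝ)
    (v : OrthonormalBasis (Fin n) ℝ (EuclideanSpace ℝ (Fin n))) :
    ∑ i, ‖Matrix.toEuclideanLin D (v i)‖ ^ 2 = ∑ k, ∑ l, D k l ^ 2 := by
  have hrow : ∀ i k, (Matrix.toEuclideanLin D (v i)) k =
      inner ℝ (WithLp.toLp 2 (D k) : EuclideanSpace ℝ (Fin n)) (v i) := by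
    intro i k
    simp [Matrix.toLpLin_apply, PiLp.inner_apply, Matrix.mulVec, dotProduct, mul_comm]
  simp_rw [EuclideanSpace.real_norm_sq_eq, hrow]
  rw [Finset.sum_comm]
  refine Finset.sum_congr rfl fun k _ => ?_
  rw [v.sum_sq_inner_left, EuclideanSpace.real_norm_sq_eq]

theorem sum_sq_matrixQuadForm_le (D : Matrix (Fin n) (Fin n) ℝ)
    (v : OrthonormalBasis (Fin n) ℝ (EuclideanSpace ℝ (Fin n))) :
    ∑ i, matrixQuadForm D (v i) ^ 2 ≤ ∑ k, ∑ l, D k l ^ 2 := by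
  rw [← sum_sq_norm_toEuclideanLin D v]
  refine Finset.sum_le_sum fun i _ => ?_
  have h := abs_real_inner_le_norm (v i) (Matrix.toEuclideanLin D (v i))
  rw [v.orthonormal.1 i, one_mul] at h
  exact sq_le_sq.mpr (by rwa [abs_norm])

/-- The upper and lower triangles have equal square sums and together cover every entry. The factor
2 is the price of storing each off-diagonal entry once. -/
theorem sum_sq_le_two_mul_norm_upperEntries_sq (A : symMatrix n) :
    ∑ k, ∑ l, (A : Matrix (Fin n) (Fin n) ℝ) k l ^ 2 ≤ 2 * ‖upperEntries A‖ ^ 2 := by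
  have hsymm : ∀ k l, (A : Matrix (Fin n) (Fin n) ℝ) k l = (A : Matrix (Fin n) (Fin n) ℝ) l k :=
    fun k l => (Matrix.IsSymm.apply A.2 l k).symm ▸ rfl
  set a : Fin n × Fin n → ℝ := fun q => (A : Matrix (Fin n) (Fin n) ℝ) q.1 q.2 ^ 2 with ha
  have hup : ‖upperEntries A‖ ^ 2 = ∑ q : Fin n × Fin n, if q.1 ≤ q.2 then a q else 0 := by
    rw [EuclideanSpace.real_norm_sq_eq, ← Finset.sum_filter]
    exact (Finset.sum_subtype (Finset.univ.filter fun q : Fin n × Fin n => q.1 ≤ q.2)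
      (by simp) a).symm
  have hlow : (∑ q : Fin n × Fin n, if q.1 ≤ q.2 then a q else 0) =
      ∑ q : Fin n × Fin n, if q.2 ≤ q.1 then a q else 0 := by
    refine Fintype.sum_equiv (Equiv.prodComm _ _) _ _ fun q => ?_
    simp [ha, hsymm q.1 q.2]
  rw [← Fintype.sum_prod_type' fun k l => (A : Matrix (Fin n) (Fin n) ℝ) k l ^ 2, two_mul, hup]
  nth_rewrite 2 [hlow]
  rw [← Finset.sum_add_distrib]
  refine Finset.sum_le_sum fun q _ => ?_
  have h0 : 0 ≤ a q := sq_nonneg _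
  change a q ≤ _
  rcases le_total q.1 q.2 with h | h <;> simp only [h, if_true] <;> split_ifs <;> linarith

/-- The trace functional `A ↦ ∑ f(λᵢ(A))` of a convex function is convex. -/
theorem convexOn_spectralAverage {f : ℝ → ℝ} (hf : ConvexOn ℝ Set.univ f) :
    ConvexOn ℝ Set.univ fun A : symMatrix n => spectralAverage A f := by
  refine ⟨convex_univ, fun A _ B _ s t hs ht hst => ?_⟩
  set v := (symMatrix_isHermitian (s • A + t • B)).eigenvectorBasis with hv
  have key : ∀ i, f ((symMatrix_isHermitian (s • A + t • B)).eigenvalues i) ≤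
      s * f (matrixQuadForm A (v i)) + t * f (matrixQuadForm B (v i)) := by
    intro i
    rw [← matrixQuadForm_eigenvectorBasis (symMatrix_isHermitian (s • A + t • B)) i, ← hv]
    have : ((s • A + t • B : symMatrix n) : Matrix (Fin n) (Fin n) ℝ) =
      s • (A : Matrix (Fin n) (Fin n) ℝ) + t • (B : Matrix (Fin n) (Fin n) ℝ) := rfl
    rw [this, matrixQuadForm_add, matrixQuadForm_smul, matrixQuadForm_smul]
    exact hf.2 (Set.mem_univ _) (Set.mem_univ _) hs ht hst
  have hA := sum_matrixQuadForm_le_sum_eigenvalues (symMatrix_isHermitian A) v hf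
  have hB := sum_matrixQuadForm_le_sum_eigenvalues (symMatrix_isHermitian B) v hf
  have hsum := Finset.sum_le_sum fun i (_ : i ∈ Finset.univ) => key i
  rw [Finset.sum_add_distrib, ← Finset.mul_sum, ← Finset.mul_sum] at hsum
  simp only [spectralAverage, smul_eq_mul]
  have hn : (0 : ℝ) ≤ 1 / n := by positivity
  calc _ ≤ 1 / (n : ℝ) * (s * ∑ i, f ((symMatrix_isHermitian A).eigenvalues i) +
        t * ∑ i, f ((symMatrix_isHermitian B).eigenvalues i)) := by
        gcongr
        exact hsum.trans (by gcongr)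
    _ = _ := by ring

/-- In the eigenbasis of `B`, Peierls bounds the sum for `A` from below by its diagonal entries.
What remains is the diagonal of `B - A`, controlled by Cauchy–Schwarz and the Frobenius norm, with
no matching of the two spectra. -/
theorem spectralAverage_sub_le {f : ℝ → ℝ} (hf : ConvexOn ℝ Set.univ f) {L : ℝ≥0}
    (hL : LipschitzWith L f) (A B : symMatrix n) :
    spectralAverage B f - spectralAverage A f ≤
      L * √(2 / n) * ‖upperEntries (B - A)‖ := by
  set v := (symMatrix_isHermitian B).eigenvectorBasis with hv
  set D : Matrix (Fin n) (Fin n) ℝ := ((B - A : symMatrix n) : Matrix (Fin n) (Fin n) ℝ) with hD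
  have hA := sum_matrixQuadForm_le_sum_eigenvalues (symMatrix_isHermitian A) v hf
  have key : ∀ i, f ((symMatrix_isHermitian B).eigenvalues i) - f (matrixQuadForm A (v i)) ≤
      L * |matrixQuadForm D (v i)| := by
    intro i
    rw [← matrixQuadForm_eigenvectorBasis (symMatrix_isHermitian B) i, ← hv]
    have : D = (B : Matrix (Fin n) (Fin n) ℝ) - A := rfl
    rw [this, matrixQuadForm_sub]
    exact (le_abs_self _).trans (hL.dist_le_mul _ _)
  have hsum := Finset.sum_le_sum fun i (_ : i ∈ Finset.univ) => key i
  rw [Finset.sum_sub_distrib, ← Finset.mul_sum] at hsum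
  have hcs : ∑ i, |matrixQuadForm D (v i)| ≤ √(n * (2 * ‖upperEntries (B - A)‖ ^ 2)) := by
    apply Real.le_sqrt_of_sq_le
    refine (sq_sum_le_card_mul_sum_sq).trans ?_
    simp only [sq_abs, Finset.card_univ, Fintype.card_fin]
    gcongr
    exact (sum_sq_matrixQuadForm_le D v).trans (sum_sq_le_two_mul_norm_upperEntries_sq (B - A))
  have hn : (0 : ℝ) ≤ 1 / n := by positivity
  have hconst : 1 / (n : ℝ) * √(n * (2 * ‖upperEntries (B - A)‖ ^ 2)) =
      √(2 / n) * ‖upperEntries (B - A)‖ := by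
    rw [← mul_assoc, Real.sqrt_mul (by positivity), Real.sqrt_sq (norm_nonneg _), ← mul_assoc]
    congr 1
    rcases Nat.eq_zero_or_pos n with h | h
    · simp [h]
    · have h0 : (0 : ℝ) < n := by exact_mod_cast h
      rw [eq_comm, Real.sqrt_eq_iff_mul_self_eq (by positivity) (by positivity), mul_mul_mul_comm,
        Real.mul_self_sqrt (by positivity)]
      field_simp
  calc spectralAverage B f - spectralAverage A f
      = 1 / (n : ℝ) * (∑ i, f ((symMatrix_isHermitian B).eigenvalues i) -
          ∑ i, f ((symMatrix_isHermitian A).eigenvalues i)) := by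
        simp only [spectralAverage]; ring
    _ ≤ 1 / (n : ℝ) * (L * √(n * (2 * ‖upperEntries (B - A)‖ ^ 2))) := by
        gcongr
        have : (L : ℝ) * ∑ i, |matrixQuadForm D (v i)| ≤
          L * √(n * (2 * ‖upperEntries (B - A)‖ ^ 2)) := by gcongr
        linarith
    _ = _ := by rw [mul_left_comm, hconst, mul_assoc]

end Spectral

/-! ### Scalar inequalities for Talagrand's induction. -/

section ConvexConcentration

theorem exp_quarter_le_two_sub {r : ℝ} (hr : r < Real.exp (-(1 / 2))) :
    Real.exp (1 / 4) ≤ 2 - r := by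
  have h1 : Real.exp (1 / 4) ≤ 4 / 3 := by
    have h := Real.add_one_le_exp (-(1 / 4 : ℝ))
    rw [Real.exp_neg] at h
    rw [← inv_inv (Real.exp (1 / 4))]
    exact (inv_anti₀ (by norm_num) h).trans (by norm_num)
  have h2 : Real.exp (-(1 / 2)) ≤ 8 / 13 := by
    have h := Real.quadratic_le_exp_of_nonneg (show (0 : ℝ) ≤ 1 / 2 by norm_num)
    rw [Real.exp_neg]
    exact (inv_anti₀ (by norm_num) h).trans (by norm_num)
  linarith

theorem add_half_sq_le_neg_log_one_sub {u : ℝ} (h0 : 0 ≤ u) (h1 : u < 1) :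
    u + u ^ 2 / 2 ≤ -Real.log (1 - u) := by
  have h := sum_le_hasSum (Finset.range 2) (fun i _ => by positivity)
    (Real.hasSum_pow_div_log_of_abs_lt_one (x := u) (by rwa [abs_of_nonneg h0]))
  simp only [Finset.sum_range_succ, Finset.sum_range_zero] at h
  norm_num at h
  linarith

/-- The optimization over the interpolation parameter in Talagrand's induction. -/
theorem exists_interpolation_parameter {r : ℝ} (hr : Real.exp (-(1 / 2)) ≤ r) (hr1 : r ≤ 1) :
    ∃ l ∈ Set.Icc (0 : ℝ) 1, Real.exp ((1 - l) ^ 2 / 4) * r⁻¹ ^ l ≤ 2 - r := by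
  have hr0 : 0 < r := (Real.exp_pos _).trans_le hr
  have hlog : -(1 / 2) ≤ Real.log r := (Real.le_log_iff_exp_le hr0).mpr hr
  have hlog' : Real.log r ≤ 0 := Real.log_nonpos hr0.le hr1
  -- This is the critical point of `(1 - l) ^ 2 / 4 - l * log r`; it is nonnegative exactly when `r
  -- ≥ exp (-1/2)`. With `r = 1 - u` the claim becomes `log (1 - u²) + log (1 - u) ^ 2 ≥ 0`.
  refine ⟨1 + 2 * Real.log r, ⟨by linarith, by linarith⟩, ?_⟩
  rw [Real.rpow_def_of_pos (inv_pos.mpr hr0), Real.log_inv, ← Real.exp_add,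
    ← Real.le_log_iff_exp_le (by linarith)]
  obtain ⟨u, rfl⟩ : ∃ u, r = 1 - u := ⟨1 - r, by ring⟩
  have hu0 : 0 ≤ u := by linarith
  have hu : u ≤ 1 / 2 := by
    have := Real.add_one_le_exp (-(1 / 2 : ℝ))
    linarith
  have h1 := add_half_sq_le_neg_log_one_sub hu0 (by linarith)
  have h2 : -(u ^ 2 / (1 - u ^ 2)) ≤ Real.log (1 - u) + Real.log (2 - (1 - u)) := by
    rw [← Real.log_mul (by linarith) (by linarith)]
    have h3 : (1 - u) * (2 - (1 - u)) = 1 - u ^ 2 := by ring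
    have hpos : 0 < 1 - u ^ 2 := by nlinarith
    rw [h3]
    refine le_trans (le_of_eq ?_) (Real.one_sub_inv_le_log_of_pos hpos)
    field_simp
    ring
  have h4 : u ^ 2 / (1 - u ^ 2) ≤ (u + u ^ 2 / 2) ^ 2 := by
    have hpos : 0 < 1 - u ^ 2 := by nlinarith
    rw [div_le_iff₀ hpos]
    have h5 : (u + u ^ 2 / 2) ^ 2 * (1 - u ^ 2) - u ^ 2 =
      u ^ 3 * (1 - 3 / 4 * u - u ^ 2 - u ^ 3 / 4) := by ring
    have h6 : 0 ≤ 1 - 3 / 4 * u - u ^ 2 - u ^ 3 / 4 := by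
      have : u ^ 2 ≤ 1 / 4 := by nlinarith
      have : u ^ 3 ≤ 1 / 8 := by nlinarith
      linarith
    nlinarith [mul_nonneg (pow_nonneg hu0 3) h6]
  have h7 : (u + u ^ 2 / 2) ^ 2 ≤ (-Real.log (1 - u)) ^ 2 :=
    pow_le_pow_left₀ (by positivity) h1 2
  nlinarith

/-! ### Transport cost to a set. -/

/-- The cost of moving `x` into `A`, when a displacement `z` costs `Φ z`. -/
noncomputable def infCost {E : Type*} [Sub E] (Φ : E → ℝ) (A : Set E) (x : E) : ℝ :=
  sInf ((fun a => Φ (x - a)) '' A)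

/-- Convex concentration on `K` for the cost `Φ`: an exponential moment bound for the cost of
moving a random point into a compact convex set. -/
def ConvexConcentration {E : Type*} [NormedAddCommGroup E] [NormedSpace ℝ E] [MeasurableSpace E]
    (μ : Measure E) (K : Set E) (Φ : E → ℝ) : Prop :=
  ∀ A ⊆ K, IsCompact A → Convex ℝ A →
    (∫⁻ x, ENNReal.ofReal (Real.exp (infCost Φ A x)) ∂μ) * μ A ≤ 1

section

variable {E : Type*} [NormedAddCommGroup E] {Φ : E → ℝ} {A : Set E}

theorem infCost_le (hΦ0 : ∀ z, 0 ≤ Φ z) {a x : E} (ha : a ∈ A) : infCost Φ A x ≤ Φ (x - a) :=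
  csInf_le ⟨0, by rintro _ ⟨a, -, rfl⟩; exact hΦ0 _⟩ ⟨a, ha, rfl⟩

theorem le_infCost (hA : A.Nonempty) {x : E} {c : ℝ} (h : ∀ a ∈ A, c ≤ Φ (x - a)) :
    c ≤ infCost Φ A x :=
  le_csInf (hA.image _) (by rintro _ ⟨a, ha, rfl⟩; exact h a ha)

theorem exists_infCost_eq (hΦ : Continuous Φ) (hA : IsCompact A) (hne : A.Nonempty) (x : E) :
    ∃ a ∈ A, infCost Φ A x = Φ (x - a) :=
  hA.exists_sInf_image_eq hne (f := fun a => Φ (x - a)) (by fun_prop)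

theorem continuous_infCost (hΦ : Continuous Φ) (hA : IsCompact A) : Continuous (infCost Φ A) :=
  hA.continuous_sInf (f := fun x a => Φ (x - a)) (by fun_prop)

end

theorem isCompact_preimage_prodMk {X Y : Type*} [TopologicalSpace X] [TopologicalSpace Y]
    [T2Space X] [T2Space Y] {A : Set (X × Y)} (hA : IsCompact A) (v : X) :
    IsCompact (Prod.mk v ⁻¹' A) :=
  (hA.image continuous_snd).of_isClosed_subset
    (hA.isClosed.preimage (Continuous.prodMk_right v)) fun x hx => ⟨(v, x), hx, rfl⟩

/-! ### Adding one independent block. -/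

section Product

theorem infCost_prod_le_infCost_image_snd {E V : Type*} [NormedAddCommGroup E]
    [NormedAddCommGroup V] {Φ : E → ℝ} {ψ : V → ℝ} {KV : Set V} {A : Set (V × E)}
    (hΦ : Continuous Φ) (hΦ0 : ∀ z, 0 ≤ Φ z)
    (hψ0 : ∀ z, 0 ≤ ψ z) (hψK : ∀ v ∈ KV, ∀ w ∈ KV, ψ (v - w) ≤ 1 / 4)
    (hAK : ∀ q ∈ A, q.1 ∈ KV) (hA : IsCompact A) (hne : A.Nonempty) {v : V} (hv : v ∈ KV)
    (x : E) :
    infCost (fun z : V × E => ψ z.1 + Φ z.2) A (v, x) ≤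
      1 / 4 + infCost Φ (Prod.snd '' A) x := by
  obtain ⟨b, ⟨⟨w, b'⟩, hb, rfl⟩, hbc⟩ := exists_infCost_eq hΦ (hA.image continuous_snd)
    (hne.image Prod.snd) x
  refine (infCost_le (fun z => add_nonneg (hψ0 _) (hΦ0 _)) hb).trans ?_
  rw [hbc]
  simpa using hψK v hv w (hAK _ hb)

variable {E V : Type*} [NormedAddCommGroup E] [NormedSpace ℝ E]
  [NormedAddCommGroup V] [NormedSpace ℝ V] {Φ : E → ℝ} {ψ : V → ℝ} {KV : Set V} {A : Set (V × E)}

/-- Mix the best point of the slice over `v` with the best point of the projection; convexity keeps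
the mixture in `A`. Its first coordinate moves by only `(1 - l) • (v - w)`, whence the quadratic
factor. -/
theorem infCost_prod_le (hΦ : Continuous Φ) (hΦ0 : ∀ z, 0 ≤ Φ z) (hΦc : ConvexOn ℝ Set.univ Φ)
    (hψ0 : ∀ z, 0 ≤ ψ z) (hψs : ∀ (c : ℝ) z, ψ (c • z) = c ^ 2 * ψ z)
    (hψK : ∀ v ∈ KV, ∀ w ∈ KV, ψ (v - w) ≤ 1 / 4) (hAK : ∀ q ∈ A, q.1 ∈ KV)
    (hA : IsCompact A) (hAc : Convex ℝ A) {v : V} (hv : v ∈ KV)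
    (hne : (Prod.mk v ⁻¹' A).Nonempty) {l : ℝ} (hl : l ∈ Set.Icc (0 : ℝ) 1) (x : E) :
    infCost (fun z : V × E => ψ z.1 + Φ z.2) A (v, x) ≤
      (1 - l) ^ 2 / 4 + l * infCost Φ (Prod.mk v ⁻¹' A) x +
        (1 - l) * infCost Φ (Prod.snd '' A) x := by
  have hsec : IsCompact (Prod.mk v ⁻¹' A) := isCompact_preimage_prodMk hA v
  obtain ⟨a, ha, hac⟩ := exists_infCost_eq hΦ hsec hne x
  obtain ⟨b, ⟨⟨w, b'⟩, hb, rfl⟩, hbc⟩ := exists_infCost_eq hΦ (hA.image continuous_snd)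
    ((show A.Nonempty from ⟨_, ha⟩).image Prod.snd) x
  have hl1 : 0 ≤ 1 - l := by linarith [hl.2]
  have hmem := hAc ha hb hl.1 hl1 (by ring)
  refine (infCost_le (fun z => add_nonneg (hψ0 _) (hΦ0 _)) hmem).trans ?_
  rw [hac, hbc]
  have e1 : v - (l • v + (1 - l) • w) = (1 - l) • (v - w) := by module
  have e2 : x - (l • a + (1 - l) • b') = l • (x - a) + (1 - l) • (x - b') := by module
  have h1 := hΦc.2 (Set.mem_univ (x - a)) (Set.mem_univ (x - b')) hl.1 hl1 (by ring)
  have h2 := hψK v hv w (hAK _ hb)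
  simp only [Prod.fst_sub, Prod.snd_sub, Prod.fst_add, Prod.snd_add, Prod.smul_fst,
    Prod.smul_snd, e1, e2, hψs, smul_eq_mul] at h1 ⊢
  nlinarith [mul_le_mul_of_nonneg_left h2 (sq_nonneg (1 - l))]

variable [MeasurableSpace E] [BorelSpace E]

/-- The exponential moment of the cost along a slice, in Talagrand's induction. -/
theorem lintegral_exp_infCost_slice_le {μ : Measure E} [IsProbabilityMeasure μ] {K : Set E}
    (hμ : ConvexConcentration μ K Φ)
    (hΦ : Continuous Φ) (hΦ0 : ∀ z, 0 ≤ Φ z) (hΦc : ConvexOn ℝ Set.univ Φ)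
    (hψ0 : ∀ z, 0 ≤ ψ z) (hψs : ∀ (c : ℝ) z, ψ (c • z) = c ^ 2 * ψ z)
    (hψK : ∀ v ∈ KV, ∀ w ∈ KV, ψ (v - w) ≤ 1 / 4) (hAK : A ⊆ KV ×ˢ K)
    (hA : IsCompact A) (hAc : Convex ℝ A) {v : V} (hv : v ∈ KV) (hB : μ (Prod.snd '' A) ≠ 0) :
    ∫⁻ x, ENNReal.ofReal (Real.exp (infCost (fun z : V × E => ψ z.1 + Φ z.2) A (v, x))) ∂μ +
      μ (Prod.mk v ⁻¹' A) * ENNReal.ofReal (1 / μ.real (Prod.snd '' A) ^ 2) ≤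
      ENNReal.ofReal (2 / μ.real (Prod.snd '' A)) := by
  have hAne : A.Nonempty := by
    rw [Set.nonempty_iff_ne_empty]; rintro rfl; simp at hB
  have hAK1 : ∀ q ∈ A, q.1 ∈ KV := fun q hq => (hAK hq).1
  set B := Prod.snd '' A with hBdef
  have hBcompact : IsCompact B := hA.image continuous_snd
  set S := Prod.mk v ⁻¹' A with hS
  have hsec : IsCompact S := isCompact_preimage_prodMk hA v
  have hSc : Convex ℝ S := by
    intro x hx y hy s t hs ht hst
    have h := hAc hx hy hs ht hst
    have e : s • v + t • v = v := by rw [← add_smul, hst, one_smul]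
    simpa [hS, e] using h
  have hSB : S ⊆ B := fun x hx => ⟨(v, x), hx, rfl⟩
  have hBK : B ⊆ K := by rintro _ ⟨q, hq, rfl⟩; exact (hAK hq).2
  have hBc : Convex ℝ B := hAc.is_linear_image (LinearMap.snd ℝ V E).isLinear
  have hintB : ∫⁻ x, ENNReal.ofReal (Real.exp (infCost Φ B x)) ∂μ ≤ (μ B)⁻¹ :=
    ENNReal.le_inv_iff_mul_le.mpr (hμ B hBK hBcompact hBc)
  have hintS : ∫⁻ x, ENNReal.ofReal (Real.exp (infCost Φ S x)) ∂μ ≤ (μ S)⁻¹ :=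
    ENNReal.le_inv_iff_mul_le.mpr (hμ S (hSB.trans hBK) hsec hSc)
  set b := μ.real B with hb
  set a := μ.real S with ha
  have hb0 : 0 < b := ENNReal.toReal_pos hB (measure_ne_top _ _)
  have ha0 : 0 ≤ a := measureReal_nonneg
  have hab : a ≤ b := measureReal_mono hSB
  have hμB : μ B = ENNReal.ofReal b := (ofReal_measureReal).symm
  have hμS : μ S = ENNReal.ofReal a := (ofReal_measureReal).symm
  have hr1 : a / b ≤ 1 := div_le_one_of_le₀ hab hb0.le
  -- The additive form of the goal avoids subtraction in `ENNReal` and is affine in the slice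
  -- measure, so it can be integrated over `v`.
  suffices h : ∫⁻ x, ENNReal.ofReal
      (Real.exp (infCost (fun z : V × E => ψ z.1 + Φ z.2) A (v, x))) ∂μ ≤
      ENNReal.ofReal ((2 - a / b) * b⁻¹) by
    refine (add_le_add_left h _).trans ?_
    rw [hμS, ← ENNReal.ofReal_mul ha0, ← ENNReal.ofReal_add
      (mul_nonneg (by linarith) (by positivity)) (by positivity)]
    refine ENNReal.ofReal_le_ofReal (le_of_eq ?_)
    field_simp
    ring
  -- A relatively small slice is ignored and only the projection is used (`l = 0`). Otherwise both
  -- are interpolated, using Hölder with exponents `l` and `1 - l`.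
  rcases lt_or_ge (a / b) (Real.exp (-(1 / 2))) with hr | hr
  · calc _ ≤ ∫⁻ x, ENNReal.ofReal (Real.exp (1 / 4)) *
          ENNReal.ofReal (Real.exp (infCost Φ B x)) ∂μ := by
          refine lintegral_mono fun x => ?_
          rw [← ENNReal.ofReal_mul (Real.exp_nonneg _), ← Real.exp_add]
          gcongr
          exact infCost_prod_le_infCost_image_snd hΦ hΦ0 hψ0 hψK hAK1 hA hAne hv x
      _ = ENNReal.ofReal (Real.exp (1 / 4)) *
          ∫⁻ x, ENNReal.ofReal (Real.exp (infCost Φ B x)) ∂μ :=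
          lintegral_const_mul' _ _ ENNReal.ofReal_ne_top
      _ ≤ ENNReal.ofReal (2 - a / b) * ENNReal.ofReal b⁻¹ := by
          rw [hμB, ← ENNReal.ofReal_inv_of_pos hb0] at hintB
          gcongr
          exact exp_quarter_le_two_sub hr
      _ = _ := (ENNReal.ofReal_mul (by linarith)).symm
  · have hr0 : 0 < a / b := (Real.exp_pos _).trans_le hr
    have ha1 : 0 < a := by
      rcases ha0.eq_or_lt with h | h
      · simp [← h] at hr0
      · exact h
    have hSne : S.Nonempty := by
      rw [Set.nonempty_iff_ne_empty]
      intro h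
      simp [ha, h] at ha1
    obtain ⟨l, hl, hlr⟩ := exists_interpolation_parameter hr hr1
    have hl1 : 0 ≤ 1 - l := by linarith [hl.2]
    rw [hμB, ← ENNReal.ofReal_inv_of_pos hb0] at hintB
    rw [hμS, ← ENNReal.ofReal_inv_of_pos ha1] at hintS
    have hpow : ∀ t c : ℝ, ENNReal.ofReal (Real.exp (t * c)) = ENNReal.ofReal (Real.exp c) ^ t :=
      fun t c => by rw [ENNReal.ofReal_rpow_of_pos (Real.exp_pos _), ← Real.exp_mul, mul_comm]
    have hmeas : ∀ T : Set E, IsCompact T →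
        AEMeasurable (fun x => ENNReal.ofReal (Real.exp (infCost Φ T x))) μ := fun T hT =>
      (ENNReal.continuous_ofReal.comp
        (Real.continuous_exp.comp (continuous_infCost hΦ hT))).measurable.aemeasurable
    calc _ ≤ ∫⁻ x, ENNReal.ofReal (Real.exp ((1 - l) ^ 2 / 4)) *
          (ENNReal.ofReal (Real.exp (infCost Φ S x)) ^ l *
            ENNReal.ofReal (Real.exp (infCost Φ B x)) ^ (1 - l)) ∂μ := by
          refine lintegral_mono fun x => ?_
          rw [← hpow, ← hpow, ← ENNReal.ofReal_mul (Real.exp_nonneg _), ← Real.exp_add,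
            ← ENNReal.ofReal_mul (Real.exp_nonneg _), ← Real.exp_add, ← add_assoc]
          gcongr
          exact infCost_prod_le hΦ hΦ0 hΦc hψ0 hψs hψK hAK1 hA hAc hv hSne hl x
      _ = ENNReal.ofReal (Real.exp ((1 - l) ^ 2 / 4)) *
          ∫⁻ x, ENNReal.ofReal (Real.exp (infCost Φ S x)) ^ l *
            ENNReal.ofReal (Real.exp (infCost Φ B x)) ^ (1 - l) ∂μ :=
          lintegral_const_mul' _ _ ENNReal.ofReal_ne_top
      _ ≤ ENNReal.ofReal (Real.exp ((1 - l) ^ 2 / 4)) *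
          ((∫⁻ x, ENNReal.ofReal (Real.exp (infCost Φ S x)) ∂μ) ^ l *
          (∫⁻ x, ENNReal.ofReal (Real.exp (infCost Φ B x)) ∂μ) ^ (1 - l)) := by
          gcongr
          exact ENNReal.lintegral_mul_norm_pow_le (hmeas S hsec) (hmeas B hBcompact) hl.1 hl1
            (by ring)
      _ ≤ ENNReal.ofReal (Real.exp ((1 - l) ^ 2 / 4)) *
          (ENNReal.ofReal a⁻¹ ^ l * ENNReal.ofReal b⁻¹ ^ (1 - l)) := by
          have := hl.1
          gcongr
      _ ≤ ENNReal.ofReal ((2 - a / b) * b⁻¹) := by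
          rw [ENNReal.ofReal_rpow_of_pos (by positivity), ENNReal.ofReal_rpow_of_pos (by positivity),
            ← ENNReal.ofReal_mul (by positivity), ← ENNReal.ofReal_mul (by positivity)]
          refine ENNReal.ofReal_le_ofReal ?_
          have e : a⁻¹ ^ l * b⁻¹ ^ (1 - l) = (a / b)⁻¹ ^ l * b⁻¹ := by
            have : a⁻¹ = (a / b)⁻¹ * b⁻¹ := by field_simp
            rw [this, Real.mul_rpow (by positivity) (by positivity), mul_assoc,
              ← Real.rpow_add (by positivity)]
            simp
          rw [e, ← mul_assoc]
          gcongr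

theorem ConvexConcentration.prod [MeasurableSpace V] [BorelSpace V]
    [SecondCountableTopology E] [SecondCountableTopology V]
    {μ : Measure E} [IsProbabilityMeasure μ] {ν : Measure V} [IsProbabilityMeasure ν] {K : Set E}
    (hμ : ConvexConcentration μ K Φ)
    (hΦ : Continuous Φ) (hΦ0 : ∀ z, 0 ≤ Φ z) (hΦc : ConvexOn ℝ Set.univ Φ)
    (hψ : Continuous ψ) (hψ0 : ∀ z, 0 ≤ ψ z) (hψs : ∀ (c : ℝ) z, ψ (c • z) = c ^ 2 * ψ z)
    (hψK : ∀ v ∈ KV, ∀ w ∈ KV, ψ (v - w) ≤ 1 / 4) (hν : ∀ᵐ v ∂ν, v ∈ KV) :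
    ConvexConcentration (ν.prod μ) (KV ×ˢ K) fun z => ψ z.1 + Φ z.2 := by
  intro A hAK hA hAc
  set B := Prod.snd '' A with hB
  have hAm : MeasurableSet A := hA.isClosed.measurableSet
  have hPB : (ν.prod μ) A ≤ μ B := by
    calc (ν.prod μ) A ≤ (ν.prod μ) (Set.univ ×ˢ B) :=
          measure_mono fun q hq => ⟨trivial, q, hq, rfl⟩
      _ = μ B := by simp
  rcases eq_or_ne (μ B) 0 with h0 | h0
  · rw [le_antisymm (hPB.trans h0.le) zero_le, mul_zero]
    exact zero_le_one
  set b := μ.real B with hb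
  have hb0 : 0 < b := ENNReal.toReal_pos h0 (measure_ne_top _ _)
  have hmeas : Measurable fun z : V × E =>
      ENNReal.ofReal (Real.exp (infCost (fun z : V × E => ψ z.1 + Φ z.2) A z)) :=
    (ENNReal.continuous_ofReal.comp
      (Real.continuous_exp.comp (continuous_infCost (by fun_prop) hA))).measurable
  set J := ∫⁻ z, ENNReal.ofReal (Real.exp (infCost (fun z : V × E => ψ z.1 + Φ z.2) A z))
    ∂(ν.prod μ) with hJ
  have hsum : J + (ν.prod μ) A * ENNReal.ofReal (1 / b ^ 2) ≤ ENNReal.ofReal (2 / b) := by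
    rw [hJ, lintegral_prod _ hmeas.aemeasurable, Measure.prod_apply hAm,
      ← lintegral_mul_const' _ _ ENNReal.ofReal_ne_top,
      ← lintegral_add_left hmeas.lintegral_prod_right']
    calc _ ≤ ∫⁻ _, ENNReal.ofReal (2 / b) ∂ν := by
          refine lintegral_mono_ae (hν.mono fun v hv => ?_)
          exact lintegral_exp_infCost_slice_le hμ hΦ hΦ0 hΦc hψ0 hψs hψK hAK hA hAc hv h0
      _ = _ := by simp
  have hJtop : J ≠ ⊤ := ne_top_of_le_ne_top ENNReal.ofReal_ne_top (le_self_add.trans hsum)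
  set P := (ν.prod μ).real A with hP
  have hPA : (ν.prod μ) A = ENNReal.ofReal P := (ofReal_measureReal).symm
  have hP0 : 0 ≤ P := measureReal_nonneg
  obtain ⟨j, hj0, hjJ⟩ : ∃ j : ℝ, 0 ≤ j ∧ J = ENNReal.ofReal j :=
    ⟨J.toReal, ENNReal.toReal_nonneg, (ENNReal.ofReal_toReal hJtop).symm⟩
  rw [hPA, hjJ, ← ENNReal.ofReal_mul hP0, ← ENNReal.ofReal_add hj0 (by positivity),
    ENNReal.ofReal_le_ofReal_iff (by positivity)] at hsum
  rw [hPA, hjJ, ← ENNReal.ofReal_mul hj0, ENNReal.ofReal_le_one]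
  -- The induction closes because `t * (2 - t) ≤ 1` for `t = P / b`.
  have h1 : j ≤ 2 / b - P * (1 / b ^ 2) := by linarith
  calc j * P ≤ (2 / b - P * (1 / b ^ 2)) * P := by gcongr
    _ = 1 - (1 - P / b) ^ 2 := by field_simp; ring
    _ ≤ 1 := by linarith [sq_nonneg (1 - P / b)]

end Product

/-- Talagrand's convex concentration inequality for products. -/
theorem convexConcentration_pi {V : Type*} [NormedAddCommGroup V] [NormedSpace ℝ V]
    [MeasurableSpace V] [BorelSpace V] [SecondCountableTopology V] {ψ : V → ℝ} {KV : Set V}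
    (hψ : Continuous ψ) (hψ0 : ∀ z, 0 ≤ ψ z) (hψs : ∀ (c : ℝ) z, ψ (c • z) = c ^ 2 * ψ z)
    (hψc : ConvexOn ℝ Set.univ ψ) (hψK : ∀ v ∈ KV, ∀ w ∈ KV, ψ (v - w) ≤ 1 / 4) :
    ∀ (m : ℕ) (ν : Fin m → Measure V) [∀ i, IsProbabilityMeasure (ν i)],
      (∀ i, ∀ᵐ v ∂(ν i), v ∈ KV) →
      ConvexConcentration (Measure.pi ν) (Set.univ.pi fun _ => KV) fun x => ∑ i, ψ (x i)
  | 0, ν, _, _ => by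
    intro A _ _ _
    rcases A.eq_empty_or_nonempty with rfl | hA
    · simp
    · have h : ∀ x, infCost (fun x : Fin 0 → V => ∑ i, ψ (x i)) A x ≤ 0 := by
        intro x
        obtain ⟨a, ha⟩ := hA
        exact (infCost_le (fun z => by simp) ha).trans (by simp)
      calc _ ≤ (∫⁻ _, 1 ∂(Measure.pi ν)) * 1 := by
            gcongr with x
            · rw [ENNReal.ofReal_le_one, Real.exp_le_one_iff]
              exact h x
            · exact prob_le_one
        _ = 1 := by simp
  | m + 1, ν, _, hν => by
    intro A hAK hA hAc
    have ih := convexConcentration_pi hψ hψ0 hψs hψc hψK m (fun j => ν (Fin.succAbove 0 j))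
      fun i => hν _
    have hconv : ConvexOn ℝ Set.univ fun x : Fin m → V => ∑ i, ψ (x i) := by
      refine ⟨convex_univ, fun x _ y _ s t hs ht hst => ?_⟩
      simp only [Pi.add_apply, Pi.smul_apply, smul_eq_mul, Finset.mul_sum,
        ← Finset.sum_add_distrib]
      exact Finset.sum_le_sum fun i _ => hψc.2 (Set.mem_univ _) (Set.mem_univ _) hs ht hst
    have hprod := ih.prod (ν := ν 0) (by fun_prop) (fun z => Finset.sum_nonneg fun i _ => hψ0 _)
      hconv hψ hψ0 hψs hψK (hν 0)
    set e := MeasurableEquiv.piFinSuccAbove (fun _ : Fin (m + 1) => V) 0 with he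
    have hmp := measurePreserving_piFinSuccAbove ν 0
    have heq : ∀ x, e x = (x 0, fun j => x (Fin.succ j)) := fun x => rfl
    have hcont : Continuous e := by
      change Continuous fun x : Fin (m + 1) → V => (x 0, fun j : Fin m => x (Fin.succ j))
      fun_prop
    have hlin : IsLinearMap ℝ e := ⟨fun x y => rfl, fun c x => rfl⟩
    -- Splitting off the first block is linear, continuous and measure preserving, so it carries the
    -- set, its convexity and the cost to the binary product.
    have h := hprod (e '' A) ?_ (hA.image hcont) (hAc.is_linear_image hlin)
    · have hcost : ∀ x, infCost (fun x : Fin (m + 1) → V => ∑ i, ψ (x i)) A x =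
          infCost (fun z : V × (Fin m → V) => ψ z.1 + ∑ i, ψ (z.2 i)) (e '' A) (e x) := by
        intro x
        simp only [infCost, Set.image_image, heq, Fin.sum_univ_succ, Prod.fst_sub, Prod.snd_sub,
          Pi.sub_apply]
      rw [hmp.lintegral_map_equiv, ← hmp.measure_preimage_equiv, Set.preimage_image_eq _ e.injective]
        at h
      simpa only [hcost] using h
    · rintro _ ⟨x, hx, rfl⟩
      exact ⟨hAK hx 0 trivial, fun j _ => hAK hx (Fin.succ j) trivial⟩

end ConvexConcentration

/-! ### Deviation from the median. -/

/-- Convex concentration controls the upper tail of a convex function relative to its lower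
level sets. -/
theorem ConvexConcentration.measureReal_mul_le_exp {E : Type*} [NormedAddCommGroup E]
    [NormedSpace ℝ E] [MeasurableSpace E] [BorelSpace E] {μ : Measure E} [IsProbabilityMeasure μ]
    {K : Set E} {Φ : E → ℝ} (hμ : ConvexConcentration μ K Φ) (hΦ : Continuous Φ)
    (hK : IsCompact K) (hKc : Convex ℝ K) (hμK : ∀ᵐ x ∂μ, x ∈ K)
    {h : E → ℝ} (hh : Continuous h) (hhc : ConvexOn ℝ Set.univ h) {ε τ : ℝ}
    (hτ : ∀ x y, ε ≤ h x - h y → τ ≤ Φ (x - y)) (a : ℝ) :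
    μ.real {x | a + ε ≤ h x} * μ.real {x | h x ≤ a} ≤ Real.exp (-τ) := by
  set A := K ∩ {x | h x ≤ a} with hA
  have hμA : μ {x | h x ≤ a} = μ A :=
    measure_congr (hμK.mono fun x hx => propext ⟨fun h' => ⟨hx, h'⟩, fun h' => h'.2⟩)
  rw [measureReal_def μ {x | h x ≤ a}, hμA, ← measureReal_def]
  rcases A.eq_empty_or_nonempty with h0 | hne
  · rw [h0]; simp [Real.exp_nonneg]
  have hAcomp : IsCompact A := hK.inter_right (isClosed_le hh continuous_const)
  have hAconv : Convex ℝ A := hKc.inter (by simpa using hhc.convex_le a)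
  have hcost := hμ A Set.inter_subset_left hAcomp hAconv
  have hsub : {x | a + ε ≤ h x} ⊆
      {x | ENNReal.ofReal (Real.exp τ) ≤ ENNReal.ofReal (Real.exp (infCost Φ A x))} := by
    intro x hx
    refine ENNReal.ofReal_le_ofReal (Real.exp_le_exp.mpr (le_infCost hne fun y hy => hτ x y ?_))
    have h1 : h y ≤ a := hy.2
    have h2 : a + ε ≤ h x := hx
    linarith
  have hmarkov := mul_meas_ge_le_lintegral (μ := μ)
    ((ENNReal.continuous_ofReal.comp (Real.continuous_exp.comp
      (continuous_infCost hΦ hAcomp))).measurable) (ENNReal.ofReal (Real.exp τ))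
  have hall : ENNReal.ofReal (Real.exp τ) * μ {x | a + ε ≤ h x} * μ A ≤ 1 :=
    le_trans (by gcongr; exact le_trans (mul_le_mul_right (measure_mono hsub) _) hmarkov) hcost
  have hreal := ENNReal.toReal_mono ENNReal.one_ne_top hall
  rw [ENNReal.toReal_mul, ENNReal.toReal_mul, ENNReal.toReal_ofReal (Real.exp_nonneg _),
    ENNReal.toReal_one, mul_assoc] at hreal
  rw [Real.exp_neg, ← one_div, le_div_iff₀' (Real.exp_pos _)]
  exact hreal

/-- Two-sided deviation from a median under convex concentration. -/
theorem ConvexConcentration.measureReal_abs_sub_median_le {E : Type*} [NormedAddCommGroup E]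
    [NormedSpace ℝ E] [MeasurableSpace E] [BorelSpace E] {μ : Measure E} [IsProbabilityMeasure μ]
    {K : Set E} {Φ : E → ℝ} (hμ : ConvexConcentration μ K Φ) (hΦ : Continuous Φ)
    (hK : IsCompact K) (hKc : Convex ℝ K) (hμK : ∀ᵐ x ∂μ, x ∈ K)
    {h : E → ℝ} (hh : Continuous h) (hhc : ConvexOn ℝ Set.univ h) {ε τ : ℝ}
    (hτ : ∀ x y, ε ≤ h x - h y → τ ≤ Φ (x - y)) {med : ℝ} (hmed : IsMedian μ h med) :
    μ.real {x | ε ≤ |h x - med|} ≤ 4 * Real.exp (-τ) := by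
  have h1 := hμ.measureReal_mul_le_exp hΦ hK hKc hμK hh hhc hτ med
  -- Level `med` gives the upper tail. Level `med - ε` gives the lower tail, since the other factor
  -- is then the mass above `med`. Each tail is at most `2 * exp (-τ)`.
  have h2 := hμ.measureReal_mul_le_exp hΦ hK hKc hμK hh hhc hτ (med - ε)
  rw [sub_add_cancel] at h2
  have hsub : {x | ε ≤ |h x - med|} ⊆ {x | med + ε ≤ h x} ∪ {x | h x ≤ med - ε} := by
    intro x hx
    rcases le_abs.mp (show ε ≤ |h x - med| from hx) with h' | h'
    · left; change med + ε ≤ h x; linarith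
    · right; change h x ≤ med - ε; linarith
  have h3 := (measureReal_mono (μ := μ) hsub).trans (measureReal_union_le _ _)
  have h4 : 0 ≤ μ.real {x | med + ε ≤ h x} := measureReal_nonneg
  have h5 : 0 ≤ μ.real {x | h x ≤ med - ε} := measureReal_nonneg
  nlinarith [mul_le_mul_of_nonneg_left hmed.1 h4, mul_le_mul_of_nonneg_right hmed.2 h5]

/-! ### Application to the random matrix. -/

theorem IsMedian.eq_of_const {Ω : Type*} [MeasurableSpace Ω] {μ : Measure Ω} {X : Ω → ℝ}
    {med k : ℝ} (hmed : IsMedian μ X med) (hX : ∀ ω, X ω = k) : med = k := by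
  obtain ⟨h1, h2⟩ := hmed
  simp only [hX] at h1 h2
  refine le_antisymm (not_lt.mp fun h => ?_) (not_lt.mp fun h => ?_)
  · simp [not_le.mpr h] at h2; norm_num at h2
  · simp [not_le.mpr h] at h1; norm_num at h1

/-- The cube contains a neighbourhood of the origin, so any vector can be scaled into it, and
linearity cancels the scaling. The Lipschitz bound thus becomes global. -/
theorem norm_le_of_lipschitzOnWith_unitCube {m p : ℕ} {G : Type*} [NormedAddCommGroup G]
    [NormedSpace ℝ G] {T : EuclideanSpace ℝ (Fin m × Fin p) →ₗ[ℝ] G} {C : ℝ≥0}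
    (hT : LipschitzOnWith C T (unitCube m p)) (z : EuclideanSpace ℝ (Fin m × Fin p)) :
    ‖T z‖ ≤ C * ‖z‖ := by
  have hz0 : (0 : EuclideanSpace ℝ (Fin m × Fin p)) ∈ unitCube m p := fun q => by simp
  set t : ℝ := (1 + ‖z‖)⁻¹ with ht
  have ht0 : 0 < t := by positivity
  have hz : t • z ∈ unitCube m p := by
    intro q
    have h1 : |z q| ≤ ‖z‖ := PiLp.norm_apply_le z q
    have : |t * z q| ≤ 1 := by
      rw [abs_mul, abs_of_pos ht0, ht, inv_mul_le_one₀ (by positivity)]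
      linarith
    exact abs_le.mp this
  have h := hT.dist_le_mul _ hz _ hz0
  rw [dist_eq_norm, dist_eq_norm, map_zero, sub_zero, sub_zero, map_smul, norm_smul, norm_smul,
    mul_left_comm, Real.norm_of_nonneg ht0.le] at h
  exact le_of_mul_le_mul_left h ht0

/-- `upperEntries` as a linear map. -/
noncomputable def upperEntriesLinearMap (n : ℕ) :
    symMatrix n →ₗ[ℝ] EuclideanSpace ℝ {q : Fin n × Fin n // q.1 ≤ q.2} where
  toFun := upperEntries
  map_add' _ _ := rfl
  map_smul' _ _ := rfl

/-- `stack` as a linear map. -/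
noncomputable def stackLinearMap (m p : ℕ) :
    (Fin m → Fin p → ℝ) →ₗ[ℝ] EuclideanSpace ℝ (Fin m × Fin p) where
  toFun := stack
  map_add' _ _ := rfl
  map_smul' _ _ := rfl

theorem convexOn_sum_sq_div {p : ℕ} {c : ℝ} (hc : 0 ≤ c) :
    ConvexOn ℝ Set.univ fun v : Fin p → ℝ => (∑ j, v j ^ 2) / c := by
  refine ⟨convex_univ, fun x _ y _ s t hs ht hst => ?_⟩
  have h : ∑ j, (s * x j + t * y j) ^ 2 ≤ s * ∑ j, x j ^ 2 + t * ∑ j, y j ^ 2 := by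
    rw [Finset.mul_sum, Finset.mul_sum, ← Finset.sum_add_distrib]
    refine Finset.sum_le_sum fun j _ => ?_
    obtain rfl : t = 1 - s := by linarith
    nlinarith [mul_nonneg (mul_nonneg hs ht) (sq_nonneg (x j - y j))]
  simp only [Pi.add_apply, Pi.smul_apply, smul_eq_mul]
  calc _ ≤ (s * ∑ j, x j ^ 2 + t * ∑ j, y j ^ 2) / c := by gcongr
    _ = _ := by ring

theorem theorem2 {Ω : Type*} [MeasurableSpace Ω] (μ : Measure Ω) [IsProbabilityMeasure μ]
    (n m p : ℕ) (hn : 1 ≤ n) (hm : 1 ≤ m) (hp : 1 ≤ p)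
    (Y : Fin m → Ω → Fin p → ℝ)
    (hY_meas : ∀ i, Measurable (Y i))
    (hY_cube : ∀ i ω j, Y i ω j ∈ Set.Icc (-1 : ℝ) 1)
    (hY_indep : iIndepFun Y μ)
    (M : EuclideanSpace ℝ (Fin m × Fin p) →ₗ[ℝ] symMatrix n) (C : ℝ≥0)
    (hM : LipschitzOnWith C (fun y => upperEntries (M y)) (unitCube m p))
    (f : ℝ → ℝ) (hf_convex : ConvexOn ℝ Set.univ f) (L : ℝ≥0) (hf_lip : LipschitzWith L f)
    (S : Ω → symMatrix n)
    (hS : ∀ ω, S ω = (1 / √(m : ℝ)) • M (stack (fun i => Y i ω)))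
    (med : ℝ) (hmed : IsMedian μ (fun ω => spectralAverage (S ω) f) med)
    (ε : ℝ) (hε : 0 < ε) :
    (C ≠ 0 → L ≠ 0 →
      μ.real {ω | ε ≤ |spectralAverage (S ω) f - med|} ≤
        4 * Real.exp (-((n * m : ℝ) / p) * (ε ^ 2 / (32 * (C : ℝ) ^ 2 * (L : ℝ) ^ 2)))) ∧
    (C = 0 ∨ L = 0 → μ.real {ω | ε ≤ |spectralAverage (S ω) f - med|} = 0) := by
  have hn0 : (0 : ℝ) < n := by exact_mod_cast hn
  have hm0 : (0 : ℝ) < m := by exact_mod_cast hm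
  have hp0 : (0 : ℝ) < p := by exact_mod_cast hp
  set T : EuclideanSpace ℝ (Fin m × Fin p) →ₗ[ℝ] symMatrix n := (1 / √(m : ℝ)) • M with hT
  set g : EuclideanSpace ℝ (Fin m × Fin p) → ℝ := fun y => spectralAverage (T y) f with hg
  set σ : ℝ := L * √(2 / n) * (1 / √(m : ℝ) * C) with hσ
  have hσ0 : 0 ≤ σ := by positivity
  have hgconv : ConvexOn ℝ Set.univ g := (convexOn_spectralAverage hf_convex).comp_linearMap T
  have hgle : ∀ y z, g y - g z ≤ σ * ‖y - z‖ := by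
    intro y z
    refine (spectralAverage_sub_le hf_convex hf_lip (T z) (T y)).trans ?_
    rw [hσ, mul_assoc (L * √(2 / n) : ℝ), mul_assoc (1 / √(m : ℝ))]
    gcongr
    have hnorm := norm_le_of_lipschitzOnWith_unitCube (T := upperEntriesLinearMap n ∘ₗ M) hM (y - z)
    have e : upperEntries (T y - T z) =
        (1 / √(m : ℝ)) • (upperEntriesLinearMap n ∘ₗ M) (y - z) := by
      rw [← map_sub]
      rfl
    rw [e, norm_smul, Real.norm_of_nonneg (by positivity)]
    gcongr
  have hgcont : Continuous g :=
    (LipschitzWith.of_le_add_mul ⟨σ, hσ0⟩ fun y z => by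
      have := hgle y z
      rw [dist_eq_norm]
      change g y ≤ g z + σ * ‖y - z‖
      linarith).continuous
  set h : (Fin m → Fin p → ℝ) → ℝ := fun x => g (stack x) with hh
  have hSh : ∀ ω, spectralAverage (S ω) f = h fun i => Y i ω := fun ω => by rw [hS ω]; rfl
  simp only [hSh] at hmed ⊢
  refine ⟨fun hC hL => ?_, fun hCL => ?_⟩
  · have hC0 : (0 : ℝ) < C := by positivity
    have hL0 : (0 : ℝ) < L := by positivity
    have hhconv : ConvexOn ℝ Set.univ h := hgconv.comp_linearMap (stackLinearMap m p)
    have hhcont : Continuous h :=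
      hgcont.comp (stackLinearMap m p).continuous_of_finiteDimensional
    set KV : Set (Fin p → ℝ) := Set.univ.pi fun _ => Set.Icc (-1 : ℝ) 1 with hKV
    -- The squared diameter of `[-1,1]^p` is `4 * p`, so `16 * p` makes the cost within a block at
    -- most `1 / 4`.
    set ψ : (Fin p → ℝ) → ℝ := fun v => (∑ j, v j ^ 2) / (16 * p) with hψ
    have hψK : ∀ v ∈ KV, ∀ w ∈ KV, ψ (v - w) ≤ 1 / 4 := by
      intro v hv w hw
      rw [hψ, div_le_iff₀ (by positivity)]
      calc ∑ j, (v - w) j ^ 2 ≤ ∑ _j : Fin p, (4 : ℝ) := by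
            refine Finset.sum_le_sum fun j _ => ?_
            have h1 := hv j trivial
            have h2 := hw j trivial
            simp only [Pi.sub_apply, Set.mem_Icc] at *
            nlinarith
        _ = 1 / 4 * (16 * p) := by simp; ring
    have hYm : Measurable fun ω i => Y i ω := measurable_pi_lambda _ hY_meas
    have hlaw := (iIndepFun_iff_map_fun_eq_pi_map fun i => (hY_meas i).aemeasurable).mp hY_indep
    have hprob : ∀ i, IsProbabilityMeasure (μ.map (Y i)) := fun i =>
      Measure.isProbabilityMeasure_map (hY_meas i).aemeasurable
    have hKVm : MeasurableSet KV := MeasurableSet.univ_pi fun _ => measurableSet_Icc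
    have hconc := convexConcentration_pi (ψ := ψ) (KV := KV) (by fun_prop)
      (fun z => by positivity)
      (fun c z => by
        simp only [hψ, Pi.smul_apply, smul_eq_mul, mul_pow, ← Finset.mul_sum, mul_div_assoc])
      (convexOn_sum_sq_div (by positivity)) hψK m (fun i => μ.map (Y i))
      (fun i => (ae_map_iff (hY_meas i).aemeasurable hKVm).mpr
        (Filter.Eventually.of_forall fun ω j _ => hY_cube i ω j))
    rw [← hlaw] at hconc
    have := Measure.isProbabilityMeasure_map (μ := μ) hYm.aemeasurable
    have hmap : ∀ s : Set ℝ, MeasurableSet s → (μ.map fun ω i => Y i ω).real (h ⁻¹' s) =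
        μ.real {ω | h (fun i => Y i ω) ∈ s} := fun s hs =>
      map_measureReal_apply hYm (hhcont.measurable hs)
    have hmed' : IsMedian (μ.map fun ω i => Y i ω) h med :=
      ⟨hmed.1.trans_eq (hmap _ measurableSet_Iic).symm,
        hmed.2.trans_eq (hmap _ measurableSet_Ici).symm⟩
    have htail := hconc.measureReal_abs_sub_median_le (by fun_prop)
      (isCompact_univ_pi fun _ => isCompact_univ_pi fun _ => isCompact_Icc)
      (convex_pi fun _ _ => convex_pi fun _ _ => convex_Icc _ _)
      ((ae_map_iff hYm.aemeasurable (MeasurableSet.univ_pi fun _ => hKVm)).mpr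
        (Filter.Eventually.of_forall fun ω i _ j _ => hY_cube i ω j))
      hhcont hhconv (ε := ε)
      (τ := (n * m : ℝ) / p * (ε ^ 2 / (32 * (C : ℝ) ^ 2 * (L : ℝ) ^ 2))) ?_ hmed'
    · rw [neg_mul]
      exact (hmap {t | ε ≤ |t - med|} (measurableSet_le measurable_const (by fun_prop))) ▸ htail
    · intro x y hxy
      have h1 : ε ≤ σ * ‖stack x - stack y‖ := hxy.trans (hgle _ _)
      have h2 : ε ^ 2 ≤ σ ^ 2 * ‖stack x - stack y‖ ^ 2 := by
        rw [← mul_pow]; exact pow_le_pow_left₀ hε.le h1 2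
      have h3 : ‖stack x - stack y‖ ^ 2 = ∑ i, ∑ j, (x i j - y i j) ^ 2 := by
        rw [EuclideanSpace.real_norm_sq_eq, Fintype.sum_prod_type]
        rfl
      have h4 : σ ^ 2 = 2 * L ^ 2 * C ^ 2 / (n * m) := by
        rw [hσ, mul_pow, mul_pow, mul_pow, div_pow, Real.sq_sqrt (by positivity),
          Real.sq_sqrt (by positivity)]
        field_simp
      rw [h4, h3] at h2
      simp only [hψ, Pi.sub_apply, ← Finset.sum_div]
      calc (n * m : ℝ) / p * (ε ^ 2 / (32 * (C : ℝ) ^ 2 * (L : ℝ) ^ 2))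
          ≤ (n * m : ℝ) / p * ((2 * L ^ 2 * C ^ 2 / (n * m) * ∑ i, ∑ j, (x i j - y i j) ^ 2) /
            (32 * (C : ℝ) ^ 2 * (L : ℝ) ^ 2)) := by gcongr
        _ = (∑ i, ∑ j, (x i j - y i j) ^ 2) / (16 * p) := by
          field_simp
          ring
  -- In the degenerate case the spectral average is constant, hence equal to its median, and the
  -- event is empty.
  · have hσ' : σ = 0 := by rcases hCL with h | h <;> simp [hσ, h]
    have hconst : ∀ y z, g y ≤ g z := fun y z => by
      have := hgle y z
      rw [hσ', zero_mul] at this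
      linarith
    have hk : ∀ ω, h (fun i => Y i ω) = g 0 := fun ω => le_antisymm (hconst _ _) (hconst _ _)
    have hm' := hmed.eq_of_const hk
    simp [hk, hm', not_le.mpr hε]
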